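/- Let $d\in\{2,3\}$ and let $\Omega\subset\mathbb R^d$ be a bounded open set. Write $H^2(\Omega)$ for the Sobolev space with norm $\|v\|_{2,\Omega}=(\sum_{|\alpha|\le 2}\|D^\alpha v\|_{L^2(\Omega)}^2)^{1/2}$ and seminorm $|v|_{2,\Omega}=(\sum_{|\alpha|=2}\|D^\alpha v\|_{L^2(\Omega)}^2)^{1/2}$, $H^2_0(\Omega)$ for the closure of $C_c^\infty(\Omega)$ in $H^2(\Omega)$, and $H^{-2}(\Omega)$ for its topological dual, with the dual norm $\|f\|_{-2,\Omega}=\sup_{v\in H^2_0(\Omega)\setminus\{0\}}|\langle f,v\rangle|/\|v\|_{2,\Omega}$. For every $p_0>0$ there are positive constants $C_1,c_2',c_3$, depending only on $\Omega$ and $p_0$, each of them a constant $c$ of the embedding $|v(x)|\le c\,|v|_{2,\Omega}$ (for a.e. $x\in\Omega$, for all $v\in H^2_0(\Omega)$), such that the following holds for all $c_1,c_2>0$ (for example embedding constants), all real $p\ge p_0$ and $\lambda>0$, all $f\in H^{-2}(\Omega)$ and every finite-dimensional subspace $V_h\subset H^2_0(\Omega)$. Put $$A=\operatorname{mes}(\Omega)\,c_1^{2p}c_2\|f\|_{-2,\Omega}^{2p},\qquad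 B=\operatorname{mes}(\Omega)\,4p\,C_1^{2p}c_2'c_3\|f\|_{-2,\Omega}^{2p}.$$ Let $u_h\in V_h$ solve the discrete nonlinear problem $$\int_\Omega\Delta u_h\,\Delta v_h\,dx+\int_\Omega\lambda|u_h|^{2p}u_hv_h\,dx=\langle f,v_h\rangle\qquad\forall v_h\in V_h,$$ and let $(u_h^n)_{n\ge 0}\subset V_h$ be a sequence with arbitrary $u_h^0$ such that for every $n\ge 0$ $$\int_\Omega\Delta u_h^{n+1}\,\Delta v_h\,dx+\lambda\int_\Omega|u_h^n|^{2p}u_h^{n+1}v_h\,dx=\langle f,v_h\rangle\qquad\forall v_h\in V_h.$$ Suppose $1-\lambda A>0$ and put $q=\lambda(1-\lambda A)^{-1}B$. Then: 1. $|u_h^{n+1}-u_h|_{2,\Omega}\le q\,|u_h^n-u_h|_{2,\Omega}$ for every $n\ge 1$, and also for $n=0$ if $|u_h^0|_{2,\Omega}\le\|f\|_{-2,\Omega}$. 2. Consequently $|u_h^{n+1}-u_h|_{2,\Omega}\le q^{n}|u_h^1-u_h|_{2,\Omega}$ for all $n\ge 0$, and if $|u_h^0|_{2,\Omega}\le\|f\|_{-2,\Omega}$,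 then $|u_h^n-u_h|_{2,\Omega}\le q^n|u_h^0-u_h|_{2,\Omega}$ for all $n\ge 0$. 3. If $q<1$, then $|u_h^n-u_h|_{2,\Omega}\to 0$ as $n\to\infty$. -/

import Mathlib

open MeasureTheory TopologicalSpace Filter Topology
open scoped Distributions LineDeriv

noncomputable section

namespace Plate

/-- Multi-indices of order at most two in dimension `d`: the order zero index, the first order
indices `i`, and the second order indices `(i, j)` with `i ≤ j` (so that every multi-index `α` with
`|α| = 2` occurs exactly once). -/
abbrev MIdx (d : ℕ) : Type := Unit ⊕ Fin d ⊕ {q : Fin d × Fin d // q.1 ≤ q.2}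

/-- The order `|α|` of a multi-index. -/
def MIdx.order {d : ℕ} : MIdx d → ℕ
  | .inl _ => 0
  | .inr (.inl _) => 1
  | .inr (.inr _) => 2

variable {d : ℕ} (Ω : Opens (EuclideanSpace ℝ (Fin d)))

/-- The classical partial derivative `D^α φ` of a test function `φ ∈ C_c^∞(Ω)`. -/
def testDeriv : MIdx d → 𝓓(Ω, ℝ) → 𝓓(Ω, ℝ)
  | .inl _, φ => φ
  | .inr (.inl i), φ => ∂_{EuclideanSpace.single i (1 : ℝ)} φ
  | .inr (.inr q), φ =>
      ∂_{EuclideanSpace.single q.1.1 (1 : ℝ)} (∂_{EuclideanSpace.single q.1.2 (1 : ℝ)} φ)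

/-- The real Hilbert space `L²(Ω)` (Lebesgue measure). -/
abbrev L2 : Type := Lp ℝ 2 (volume.restrict (Ω : Set (EuclideanSpace ℝ (Fin d))))

/-- Families `(w_α)_{|α| ≤ 2}` in `L²(Ω)`, with the norm `(∑_α ‖w_α‖²_{L²})^{1/2}`. -/
abbrev Jet : Type := PiLp 2 (fun _ : MIdx d => L2 Ω)

variable {Ω}

lemma integrable_mul_test (g : L2 Ω) (φ : 𝓓(Ω, ℝ)) :
    Integrable (fun x => g x * φ x) (volume.restrict (Ω : Set (EuclideanSpace ℝ (Fin d)))) := by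
  have h1 : MemLp (fun x => φ x) 2 (volume.restrict (Ω : Set (EuclideanSpace ℝ (Fin d)))) :=
    φ.continuous.memLp_of_hasCompactSupport φ.hasCompactSupport
  exact (Lp.memLp g).integrable_mul h1

variable (Ω)

/-- The Sobolev space `H²(Ω)`. A function `u ∈ L²(Ω)` with weak derivatives `D^α u ∈ L²(Ω)`,
`|α| ≤ 2`, is represented by the family `(D^α u)_{|α| ≤ 2}`, which it determines, so that the norm
is `‖u‖_{2,Ω} = (∑_{|α| ≤ 2} ‖D^α u‖²_{L²})^{1/2}`; the function itself is the component of order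
zero. -/
def H2 : Submodule ℝ (Jet Ω) where
  carrier := {w | ∀ (α : MIdx d) (φ : 𝓓(Ω, ℝ)),
    ∫ x in (Ω : Set (EuclideanSpace ℝ (Fin d))), w α x * φ x =
      (-1) ^ α.order *
        ∫ x in (Ω : Set (EuclideanSpace ℝ (Fin d))), w (.inl ()) x * testDeriv Ω α φ x}
  zero_mem' := by
    intro α φ
    have h0 := Lp.coeFn_zero ℝ 2 (volume.restrict (Ω : Set (EuclideanSpace ℝ (Fin d))))
    have key : ∀ ψ : 𝓓(Ω, ℝ),
        ∫ x in (Ω : Set (EuclideanSpace ℝ (Fin d))), (0 : L2 Ω) x * ψ x = 0 := by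
      intro ψ
      rw [← integral_zero (EuclideanSpace ℝ (Fin d)) ℝ]
      refine integral_congr_ae ?_
      filter_upwards [h0] with x hx
      rw [hx]; simp
    simp only [PiLp.zero_apply, key, mul_zero]
  add_mem' := by
    intro v w hv hw α φ
    have key : ∀ (a b : L2 Ω) (ψ : 𝓓(Ω, ℝ)),
        ∫ x in (Ω : Set (EuclideanSpace ℝ (Fin d))), (a + b : L2 Ω) x * ψ x =
          (∫ x in (Ω : Set (EuclideanSpace ℝ (Fin d))), a x * ψ x) +
            ∫ x in (Ω : Set (EuclideanSpace ℝ (Fin d))), b x * ψ x := by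
      intro a b ψ
      rw [← integral_add (integrable_mul_test a ψ) (integrable_mul_test b ψ)]
      refine integral_congr_ae ?_
      filter_upwards [Lp.coeFn_add a b] with x hx
      rw [hx, Pi.add_apply, add_mul]
    simp only [PiLp.add_apply, key, hv α φ, hw α φ]
    ring
  smul_mem' := by
    intro c v hv α φ
    have key : ∀ (a : L2 Ω) (ψ : 𝓓(Ω, ℝ)),
        ∫ x in (Ω : Set (EuclideanSpace ℝ (Fin d))), (c • a : L2 Ω) x * ψ x =
          c * ∫ x in (Ω : Set (EuclideanSpace ℝ (Fin d))), a x * ψ x := by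
      intro a ψ
      rw [← integral_const_mul]
      refine integral_congr_ae ?_
      filter_upwards [Lp.coeFn_smul c a] with x hx
      simp [hx, mul_assoc]
    simp only [PiLp.smul_apply, key, hv α φ]
    ring

variable {Ω}

/-- The weak derivative `D^α u` of `u ∈ H²(Ω)`. -/
def weakDeriv (α : MIdx d) (u : H2 Ω) : L2 Ω := (u : Jet Ω) α

/-- The function (an element of `L²(Ω)`) underlying `u ∈ H²(Ω)`. -/
def toFun (u : H2 Ω) : L2 Ω := weakDeriv (.inl ()) u

/-- `Δu = ∑_i ∂_{ii} u`. -/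
def laplacian (u : H2 Ω) : L2 Ω := ∑ i : Fin d, weakDeriv (.inr (.inr ⟨(i, i), le_rfl⟩)) u

/-- The seminorm `|u|_{2,Ω} = (∑_{|α| = 2} ‖D^α u‖²_{L²})^{1/2}`. -/
def seminorm2 (u : H2 Ω) : ℝ :=
  Real.sqrt (∑ q : {q : Fin d × Fin d // q.1 ≤ q.2}, ‖weakDeriv (.inr (.inr q)) u‖ ^ 2)

variable (Ω)

/-- The elements of `H²(Ω)` that are (almost everywhere equal to) test functions in `C_c^∞(Ω)`. -/
def testFunctions : Set (H2 Ω) :=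
  {u | ∃ φ : 𝓓(Ω, ℝ),
    toFun u =ᵐ[volume.restrict (Ω : Set (EuclideanSpace ℝ (Fin d)))] fun x => φ x}

/-- `H²_0(Ω)`, the closure of `C_c^∞(Ω)` in `H²(Ω)` (a linear subspace already, so that taking the
span adds nothing). -/
def H20 : Submodule ℝ (H2 Ω) := (Submodule.span ℝ (testFunctions Ω)).topologicalClosure

/-- `H⁻²(Ω)`, the topological dual of `H²_0(Ω)`, with the norm
`‖f‖_{-2,Ω} = sup_{v ≠ 0} |⟨f, v⟩| / ‖v‖_{2,Ω}` (the operator norm). -/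
abbrev Hm2 : Type := StrongDual ℝ (H20 Ω)

variable {Ω}

/-- `u_h ∈ V_h` solves the discrete nonlinear problem
`∫ Δu_h Δv_h + ∫ λ |u_h|^{2p} u_h v_h = ⟨f, v_h⟩` for all `v_h ∈ V_h`. -/
def SolvesDiscrete (lam p : ℝ) (f : Hm2 Ω) (Vh : Submodule ℝ (H20 Ω)) (uh : Vh) : Prop :=
  ∀ vh : Vh,
    (∫ x in (Ω : Set (EuclideanSpace ℝ (Fin d))),
        laplacian (uh : H20 Ω).1 x * laplacian (vh : H20 Ω).1 x) +
      (∫ x in (Ω : Set (EuclideanSpace ℝ (Fin d))),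
        lam * |toFun (uh : H20 Ω).1 x| ^ (2 * p) * toFun (uh : H20 Ω).1 x *
          toFun (vh : H20 Ω).1 x) =
    f (vh : H20 Ω)

/-- `w ∈ V_h` is the result of one step of the linearized iteration started from `u ∈ V_h`:
`∫ Δw Δv_h + λ ∫ |u|^{2p} w v_h = ⟨f, v_h⟩` for all `v_h ∈ V_h`. -/
def SolvesStep (lam p : ℝ) (f : Hm2 Ω) (Vh : Submodule ℝ (H20 Ω)) (u w : Vh) : Prop :=
  ∀ vh : Vh,
    (∫ x in (Ω : Set (EuclideanSpace ℝ (Fin d))),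
        laplacian (w : H20 Ω).1 x * laplacian (vh : H20 Ω).1 x) +
      lam * (∫ x in (Ω : Set (EuclideanSpace ℝ (Fin d))),
        |toFun (u : H20 Ω).1 x| ^ (2 * p) * toFun (w : H20 Ω).1 x * toFun (vh : H20 Ω).1 x) =
    f (vh : H20 Ω)

/-- `|v|_{2,Ω}` for `v ∈ V_h ⊆ H²_0(Ω)`. -/
def semi {Vh : Submodule ℝ (H20 Ω)} (v : Vh) : ℝ := seminorm2 (v : H20 Ω).1

variable (Ω)

/-- `c` is a constant of the embedding of `H²_0(Ω)` into the bounded functions: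
`|v| ≤ c |v|_{2,Ω}` almost everywhere in `Ω`, for all `v ∈ H²_0(Ω)`. -/
def IsEmbeddingConst (c : ℝ) : Prop :=
  ∀ v : H20 Ω, ∀ᵐ x ∂(volume.restrict (Ω : Set (EuclideanSpace ℝ (Fin d)))),
    |toFun v.1 x| ≤ c * seminorm2 v.1

/-- `A = mes(Ω) c₁^{2p} c₂ ‖f‖_{-2,Ω}^{2p}`. -/
def constA (c₁ c₂ p : ℝ) (f : Hm2 Ω) : ℝ :=
  volume.real (Ω : Set (EuclideanSpace ℝ (Fin d))) * c₁ ^ (2 * p) * c₂ * ‖f‖ ^ (2 * p)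

/-- `B = mes(Ω) 4p C₁^{2p} c₂' c₃ ‖f‖_{-2,Ω}^{2p}`. -/
def constB (C₁ c₂' c₃ p : ℝ) (f : Hm2 Ω) : ℝ :=
  volume.real (Ω : Set (EuclideanSpace ℝ (Fin d))) * (4 * p) * C₁ ^ (2 * p) * c₂' * c₃ *
    ‖f‖ ^ (2 * p)

end Plate

end

/-! The exact solution is a fixed point of the linearized step, so the error e = w - u_h of one step
from u satisfies, after testing both equations with e, ‖Δe‖² = -λ ∫ (|u|^{2p} w - |u_h|^{2p} u_h) e.
The integrand splits as |u|^{2p} e² + (|u|^{2p} - |u_h|^{2p}) u_h e. The first term has a good sign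
and is dropped; the second is at most max(2p, 1) M^{2p} |u - u_h| |e| wherever |u|, |u_h| ≤ M
(`abs_rpow_sub_rpow_mul_le`). The embedding into bounded functions turns every pointwise factor into
a seminorm, and dividing by |e|₂ gives the contraction (`SolvesStep.semi_sub_le`).

Three facts about H²₀(Ω) feed this: |v|₂ ≤ ‖Δv‖ (integration by parts), ‖v‖₂ ≤ K |v|₂ (Poincaré),
and |v| ≤ c |v|₂ a.e. (Fourier inversion and Cauchy–Schwarz, for d < 4). Each is proved for test
functions and extended by closedness. The first two also give the a priori bound |w|₂ ≤ K ‖f‖, hence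
M = cK‖f‖.

The quantity A plays no real role: (1 - λA)⁻¹ ≥ 1 only enlarges q beyond the factor λB that is
actually proved. -/

noncomputable section

namespace Plate

/-! ### Test functions: integration by parts and the Poincaré inequality. -/

section TestFunctions

open scoped ContDiff RealInnerProductSpace

variable {d : ℕ} {Ω : Opens (EuclideanSpace ℝ (Fin d))}

/-- The `i`-th standard basis vector. -/
abbrev basisVec (i : Fin d) : EuclideanSpace ℝ (Fin d) := EuclideanSpace.single i (1 : ℝ)

lemma lineDeriv_apply (v : EuclideanSpace ℝ (Fin d)) (φ : 𝓓(Ω, ℝ)) (x : EuclideanSpace ℝ (Fin d)) :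
    (∂_{v} φ) x = fderiv ℝ φ x v := by
  rw [TestFunction.lineDerivOp_eq_lineDerivCLM (𝕜 := ℝ), TestFunction.lineDerivCLM_eq_fderivCLM,
    TestFunction.fderivCLM_apply_of_le _ (by simp)]

lemma testFunction_eq_zero (φ : 𝓓(Ω, ℝ)) {x : EuclideanSpace ℝ (Fin d)} (hx : x ∉ Ω) :
    φ x = 0 :=
  image_eq_zero_of_notMem_tsupport fun h => hx (φ.tsupport_subset h)

lemma testFunction_contDiff (φ : 𝓓(Ω, ℝ)) : ContDiff ℝ ∞ φ := φ.contDiff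

lemma testFunction_differentiable (φ : 𝓓(Ω, ℝ)) : Differentiable ℝ φ :=
  (testFunction_contDiff φ).differentiable (by simp)

lemma lineDeriv_comm (v w : EuclideanSpace ℝ (Fin d)) (φ : 𝓓(Ω, ℝ)) :
    ∂_{v} (∂_{w} φ) = ∂_{w} (∂_{v} φ) := by
  have hd : Differentiable ℝ (fderiv ℝ φ) :=
    ((testFunction_contDiff φ).fderiv_right (m := ∞) (by simp)).differentiable (by simp)
  have key : ∀ (a b x : EuclideanSpace ℝ (Fin d)),
      (∂_{a} (∂_{b} φ)) x = fderiv ℝ (fderiv ℝ φ) x a b := by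
    intro a b x
    have h : (⇑(∂_{b} φ : 𝓓(Ω, ℝ)) : EuclideanSpace ℝ (Fin d) → ℝ) = fun y => fderiv ℝ φ y b :=
      funext fun y => lineDeriv_apply b φ y
    rw [lineDeriv_apply, h, fderiv_clm_apply (hd x) (differentiableAt_const _)]
    simp
  ext x
  rw [key, key]
  exact second_derivative_symmetric (fun y => (testFunction_differentiable φ y).hasFDerivAt)
    (hd x).hasFDerivAt v w

lemma memLp_testFunction (φ : 𝓓(Ω, ℝ)) :
    MemLp (fun x => φ x) 2 (volume.restrict (Ω : Set (EuclideanSpace ℝ (Fin d)))) :=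
  φ.continuous.memLp_of_hasCompactSupport φ.hasCompactSupport

/-- The class in `L²(Ω)` of a test function. -/
def toL2 : 𝓓(Ω, ℝ) →ₗ[ℝ] L2 Ω where
  toFun φ := (memLp_testFunction φ).toLp _
  map_add' φ ψ := (memLp_testFunction φ).toLp_add (memLp_testFunction ψ)
  map_smul' c φ := MemLp.toLp_const_smul c (memLp_testFunction φ)

lemma coeFn_toL2 (φ : 𝓓(Ω, ℝ)) :
    toL2 φ =ᵐ[volume.restrict (Ω : Set (EuclideanSpace ℝ (Fin d)))] fun x => φ x :=
  (memLp_testFunction φ).coeFn_toLp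

lemma inner_toL2_right (g : L2 Ω) (ψ : 𝓓(Ω, ℝ)) :
    ⟪g, toL2 ψ⟫ = ∫ x in (Ω : Set (EuclideanSpace ℝ (Fin d))), g x * ψ x := by
  rw [L2.inner_def]
  refine integral_congr_ae ?_
  filter_upwards [coeFn_toL2 ψ] with x hx
  rw [hx]
  simp [mul_comm]

lemma inner_toL2 (φ ψ : 𝓓(Ω, ℝ)) : ⟪toL2 φ, toL2 ψ⟫ = ∫ x, φ x * ψ x := by
  rw [inner_toL2_right, ← setIntegral_eq_integral_of_forall_compl_eq_zero
    (s := (Ω : Set (EuclideanSpace ℝ (Fin d)))) (f := fun x => φ x * ψ x)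
    fun x hx => by rw [testFunction_eq_zero φ hx, zero_mul]]
  refine integral_congr_ae ?_
  filter_upwards [coeFn_toL2 φ] with x hx
  rw [hx]

lemma norm_toL2_sq (φ : 𝓓(Ω, ℝ)) : ‖toL2 φ‖ ^ 2 = ∫ x, φ x ^ 2 := by
  rw [← real_inner_self_eq_norm_sq, inner_toL2]
  simp only [sq]

lemma integrable_testFunction_mul (φ ψ : 𝓓(Ω, ℝ)) : Integrable (fun x => φ x * ψ x) :=
  (φ.continuous.mul ψ.continuous).integrable_of_hasCompactSupport
    φ.hasCompactSupport.mul_right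

lemma inner_lineDeriv_right (v : EuclideanSpace ℝ (Fin d)) (φ ψ : 𝓓(Ω, ℝ)) :
    ⟪toL2 φ, toL2 (∂_{v} ψ)⟫ = -⟪toL2 (∂_{v} φ), toL2 ψ⟫ := by
  have h1 := integrable_testFunction_mul (∂_{v} φ) ψ
  have h2 := integrable_testFunction_mul φ (∂_{v} ψ)
  rw [inner_toL2, inner_toL2]
  simp only [lineDeriv_apply] at h1 h2 ⊢
  exact integral_mul_fderiv_eq_neg_fderiv_mul_of_integrable h1 h2 (integrable_testFunction_mul φ ψ)
    (fun x _ => testFunction_differentiable φ x) (fun x _ => testFunction_differentiable ψ x)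

/-- Two integrations by parts and the symmetry of second derivatives. Mixed derivatives thus appear
as the cross terms of ‖Δφ‖². -/
lemma norm_lineDeriv_lineDeriv_sq (v w : EuclideanSpace ℝ (Fin d)) (φ : 𝓓(Ω, ℝ)) :
    ‖toL2 (∂_{v} (∂_{w} φ))‖ ^ 2 = ⟪toL2 (∂_{v} (∂_{v} φ)), toL2 (∂_{w} (∂_{w} φ))⟫ := by
  rw [inner_lineDeriv_right, lineDeriv_comm w v, lineDeriv_comm w v, ← inner_lineDeriv_right,
    real_inner_self_eq_norm_sq]

/-- Multiplication of a test function by the `i`-th coordinate. -/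
def coordMul (i : Fin d) (φ : 𝓓(Ω, ℝ)) : 𝓓(Ω, ℝ) where
  toFun x := x i * φ x
  contDiff' := (contDiff_euclidean.1 contDiff_id i).mul φ.contDiff
  hasCompactSupport' := φ.hasCompactSupport.mul_left
  tsupport_subset' := (tsupport_mul_subset_right).trans φ.tsupport_subset

lemma coordMul_apply (i : Fin d) (φ : 𝓓(Ω, ℝ)) (x : EuclideanSpace ℝ (Fin d)) :
    coordMul i φ x = x i * φ x := rfl

lemma lineDeriv_coordMul (i : Fin d) (φ : 𝓓(Ω, ℝ)) :
    ∂_{basisVec i} (coordMul i φ) = φ + coordMul i (∂_{basisVec i} φ) := by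
  ext x
  have h : (⇑(coordMul i φ) : EuclideanSpace ℝ (Fin d) → ℝ) =
      fun y => EuclideanSpace.proj (𝕜 := ℝ) i y * φ y := rfl
  rw [lineDeriv_apply, h, fderiv_fun_mul (by fun_prop) (testFunction_differentiable φ x)]
  have h2 : (φ + coordMul i (∂_{basisVec i} φ)) x = φ x + x i * (fderiv ℝ φ x (basisVec i)) := by
    rw [← lineDeriv_apply]; rfl
  rw [h2, ContinuousLinearMap.fderiv]
  simp
  ring

lemma inner_coordMul (i : Fin d) (φ ψ : 𝓓(Ω, ℝ)) :
    ⟪toL2 (coordMul i φ), toL2 ψ⟫ = ⟪toL2 φ, toL2 (coordMul i ψ)⟫ := by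
  simp only [inner_toL2, coordMul_apply]
  congr 1; ext x; ring

lemma norm_coordMul_le {R : ℝ} (hR : ∀ x ∈ Ω, ‖x‖ ≤ R) (i : Fin d) (φ : 𝓓(Ω, ℝ)) :
    ‖toL2 (coordMul i φ)‖ ≤ R * ‖toL2 φ‖ := by
  refine Lp.norm_le_mul_norm_of_ae_le_mul ?_
  filter_upwards [coeFn_toL2 φ, coeFn_toL2 (coordMul i φ), ae_restrict_mem Ω.isOpen.measurableSet]
    with x h1 h2 hx
  rw [h1, h2, coordMul_apply, norm_mul]
  exact mul_le_mul_of_nonneg_right ((PiLp.norm_apply_le x i).trans (hR x hx)) (norm_nonneg _)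

/-- Pairing ∂ᵢ(xᵢφ) = φ + xᵢ∂ᵢφ with φ gives ‖φ‖² = -2⟨xᵢφ, ∂ᵢφ⟩, and |xᵢ| ≤ R on Ω. -/
lemma norm_toL2_le_lineDeriv {R : ℝ} (hR₀ : 0 ≤ R) (hR : ∀ x ∈ Ω, ‖x‖ ≤ R) (i : Fin d)
    (φ : 𝓓(Ω, ℝ)) : ‖toL2 φ‖ ≤ 2 * R * ‖toL2 (∂_{basisVec i} φ)‖ := by
  rcases (norm_nonneg (toL2 φ)).eq_or_lt with h0 | h0
  · rw [← h0]; positivity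
  have h1 := inner_lineDeriv_right (basisVec i) (coordMul i φ) φ
  rw [lineDeriv_coordMul, map_add, inner_add_left, real_inner_self_eq_norm_sq,
    inner_coordMul i (∂_{basisVec i} φ), real_inner_comm] at h1
  have h2 := neg_le_of_abs_le
    (abs_real_inner_le_norm (toL2 (∂_{basisVec i} φ)) (toL2 (coordMul i φ)))
  have h3 := mul_le_mul_of_nonneg_right (norm_coordMul_le hR i φ)
    (norm_nonneg (toL2 (∂_{basisVec i} φ)))
  refine le_of_mul_le_mul_left ?_ h0
  nlinarith

/-! ### The sup bound by the Fourier transform. -/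

/-- A real test function, seen as a complex-valued Schwartz function. -/
def toSchwartz : 𝓓(Ω, ℝ) →ₗ[ℝ] SchwartzMap (EuclideanSpace ℝ (Fin d)) ℂ where
  toFun φ := HasCompactSupport.toSchwartzMap (f := fun x => (φ x : ℂ))
    (φ.hasCompactSupport.comp_left (g := ((↑) : ℝ → ℂ)) Complex.ofReal_zero)
    (Complex.ofRealCLM.contDiff.comp (testFunction_contDiff φ))
  map_add' φ ψ := by ext x; exact Complex.ofReal_add (φ x) (ψ x)
  map_smul' c φ := by ext x; exact Complex.ofReal_mul c (φ x)

lemma toSchwartz_apply (φ : 𝓓(Ω, ℝ)) (x : EuclideanSpace ℝ (Fin d)) :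
    toSchwartz φ x = φ x := rfl

lemma toSchwartz_lineDeriv (v : EuclideanSpace ℝ (Fin d)) (φ : 𝓓(Ω, ℝ)) :
    toSchwartz (∂_{v} φ) = ∂_{v} (toSchwartz φ) := by
  ext x
  have h : (⇑(toSchwartz φ) : EuclideanSpace ℝ (Fin d) → ℂ) = Complex.ofRealCLM ∘ φ := rfl
  rw [SchwartzMap.lineDerivOp_apply_eq_fderiv, toSchwartz_apply, lineDeriv_apply, h,
    fderiv_comp _ (by fun_prop) (testFunction_differentiable φ x), ContinuousLinearMap.fderiv]
  rfl

open scoped FourierTransform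

lemma fourier_lineDeriv_lineDeriv (v : EuclideanSpace ℝ (Fin d)) (φ : 𝓓(Ω, ℝ))
    (ξ : EuclideanSpace ℝ (Fin d)) :
    𝓕 (toSchwartz (∂_{v} (∂_{v} φ))) ξ =
      ((-(4 * Real.pi ^ 2) * ⟪ξ, v⟫ ^ 2 : ℝ) : ℂ) * 𝓕 (toSchwartz φ) ξ := by
  have ht : (fun y : EuclideanSpace ℝ (Fin d) => ⟪y, v⟫).HasTemperateGrowth :=
    ((innerSL ℝ).flip v).hasTemperateGrowth
  rw [toSchwartz_lineDeriv, toSchwartz_lineDeriv, SchwartzMap.fourier_lineDerivOp_eq,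
    SchwartzMap.fourier_lineDerivOp_eq]
  simp [ht]
  ring_nf
  simp

/-- The operator `1 - (2π)⁻² Δ` on test functions. -/
def besselOp (φ : 𝓓(Ω, ℝ)) : 𝓓(Ω, ℝ) :=
  φ - (4 * Real.pi ^ 2)⁻¹ • ∑ i : Fin d, ∂_{basisVec i} (∂_{basisVec i} φ)

lemma fourier_besselOp (φ : 𝓓(Ω, ℝ)) (ξ : EuclideanSpace ℝ (Fin d)) :
    𝓕 (toSchwartz (besselOp φ)) ξ = ((1 + ‖ξ‖ ^ 2 : ℝ) : ℂ) * 𝓕 (toSchwartz φ) ξ := by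
  have h : 𝓕 (toSchwartz (besselOp φ)) = 𝓕 (toSchwartz φ) - (4 * Real.pi ^ 2)⁻¹ •
      ∑ i : Fin d, 𝓕 (toSchwartz (∂_{basisVec i} (∂_{basisVec i} φ))) := by
    simp only [← FourierTransform.fourierCLM_apply (R := ℝ), besselOp, map_sub, map_smul, map_sum]
  have h2 : ∀ x, (∑ i : Fin d, 𝓕 (toSchwartz (∂_{basisVec i} (∂_{basisVec i} φ)))) x =
      ∑ i : Fin d, 𝓕 (toSchwartz (∂_{basisVec i} (∂_{basisVec i} φ))) x := by
    intro x; simp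
  rw [h, sub_apply, smul_apply, h2]
  have h3 : ∀ i : Fin d, ⟪ξ, basisVec i⟫ = ξ i := fun i => by
    simp [EuclideanSpace.inner_single_right]
  simp only [fourier_lineDeriv_lineDeriv, ← Finset.sum_mul, EuclideanSpace.norm_sq_eq, h3]
  have hpi : (Real.pi : ℂ) ≠ 0 := by exact_mod_cast Real.pi_ne_zero
  simp
  rw [← Finset.mul_sum]
  field_simp

lemma integral_norm_fourier_besselOp_sq (φ : 𝓓(Ω, ℝ)) :
    ∫ ξ, ‖𝓕 (toSchwartz (besselOp φ)) ξ‖ ^ 2 = ‖toL2 (besselOp φ)‖ ^ 2 := by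
  rw [SchwartzMap.integral_norm_sq_fourier, norm_toL2_sq]
  simp [toSchwartz_apply]

/-- Fourier inversion bounds |φ(x)| by ∫ |φ̂| = ∫ (1 + |ξ|²)⁻¹ |Ĝ| with G = (1 - (2π)⁻²Δ)φ.
Cauchy–Schwarz and Plancherel finish, since (1 + |ξ|²)⁻¹ is square integrable exactly when d < 4. -/
lemma abs_le_norm_besselOp (hd : d < 4) :
    ∃ S : ℝ, 0 ≤ S ∧ ∀ (φ : 𝓓(Ω, ℝ)) (x : EuclideanSpace ℝ (Fin d)),
      |φ x| ≤ S * ‖toL2 (besselOp φ)‖ := by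
  set w : EuclideanSpace ℝ (Fin d) → ℝ := fun ξ => (1 + ‖ξ‖ ^ 2)⁻¹ with hw
  have hwpos : ∀ ξ, 0 < w ξ := fun ξ => by positivity
  have hwc : Continuous w := by
    refine Continuous.inv₀ (by fun_prop) fun ξ => by positivity
  have hwi : Integrable (fun ξ => w ξ ^ 2) := by
    have h := integrable_rpow_neg_one_add_norm_sq (E := EuclideanSpace ℝ (Fin d)) (μ := volume)
      (r := 4) (by rw [finrank_euclideanSpace_fin]; exact_mod_cast hd)
    refine h.congr (ae_of_all _ fun ξ => ?_)
    simp only [hw]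
    rw [show (-4 / 2 : ℝ) = -((2 : ℕ) : ℝ) by norm_num, Real.rpow_neg (by positivity),
      Real.rpow_natCast, inv_pow]
  have hw2 : MemLp w 2 := (memLp_two_iff_integrable_sq hwc.aestronglyMeasurable).2 hwi
  refine ⟨Real.sqrt (∫ ξ, w ξ ^ 2), Real.sqrt_nonneg _, fun φ x => ?_⟩
  set F := 𝓕 (toSchwartz φ)
  set G := 𝓕 (toSchwartz (besselOp φ))
  have hFG : ∀ ξ, ‖F ξ‖ = w ξ * ‖G ξ‖ := by
    intro ξ
    have h1 : (0 : ℝ) < 1 + ‖ξ‖ ^ 2 := by positivity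
    rw [fourier_besselOp, norm_mul, Complex.norm_real, Real.norm_of_nonneg h1.le,
      ← mul_assoc, inv_mul_cancel₀ h1.ne', one_mul]
  have hinv : (φ x : ℂ) = ∫ ξ, 𝐞 ⟪ξ, x⟫ • F ξ := by
    have h1 : 𝓕⁻ F = toSchwartz φ := FourierTransform.fourierInv_fourier_eq (toSchwartz φ)
    rw [← toSchwartz_apply, ← h1, SchwartzMap.fourierInv_coe, Real.fourierInv_eq]
  have hG2 : MemLp (fun ξ => ‖G ξ‖) 2 := (G.memLp 2).norm
  calc |φ x| = ‖(φ x : ℂ)‖ := by simp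
    _ ≤ ∫ ξ, ‖F ξ‖ := by
      rw [hinv]
      refine (norm_integral_le_integral_norm _).trans_eq ?_
      simp
    _ = ∫ ξ, w ξ * ‖G ξ‖ := by simp only [hFG]
    _ ≤ (∫ ξ, w ξ ^ (2 : ℝ)) ^ (1 / (2 : ℝ)) * (∫ ξ, ‖G ξ‖ ^ (2 : ℝ)) ^ (1 / (2 : ℝ)) :=
      integral_mul_le_Lp_mul_Lq_of_nonneg Real.HolderConjugate.two_two
        (ae_of_all _ fun ξ => (hwpos ξ).le) (ae_of_all _ fun ξ => norm_nonneg _)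
        (by simpa using hw2) (by simpa using hG2)
    _ = Real.sqrt (∫ ξ, w ξ ^ 2) * ‖toL2 (besselOp φ)‖ := by
      simp only [Real.rpow_two, ← Real.sqrt_eq_rpow]
      rw [integral_norm_fourier_besselOp_sq, Real.sqrt_sq (norm_nonneg _)]

lemma abs_le_norm_toL2 (hd : d < 4) :
    ∃ S : ℝ, 0 ≤ S ∧ ∀ (φ : 𝓓(Ω, ℝ)) (x : EuclideanSpace ℝ (Fin d)),
      |φ x| ≤ S * (‖toL2 φ‖ + ∑ i : Fin d, ‖toL2 (∂_{basisVec i} (∂_{basisVec i} φ))‖) := by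
  obtain ⟨S, hS, h⟩ := abs_le_norm_besselOp (Ω := Ω) hd
  refine ⟨S, hS, fun φ x => (h φ x).trans (mul_le_mul_of_nonneg_left ?_ hS)⟩
  rw [besselOp, map_sub, map_smul, map_sum]
  refine (norm_sub_le _ _).trans (add_le_add_right ?_ _)
  have hpi : (4 * Real.pi ^ 2)⁻¹ ≤ 1 := inv_le_one_of_one_le₀ (by nlinarith [Real.pi_gt_three])
  rw [norm_smul, Real.norm_of_nonneg (by positivity)]
  exact (mul_le_of_le_one_left (norm_nonneg _) hpi).trans (norm_sum_le _ _)

end TestFunctions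

/-! ### From test functions to H²₀(Ω) by density. -/

section Density

open scoped ContDiff RealInnerProductSpace

variable {d : ℕ} {Ω : Opens (EuclideanSpace ℝ (Fin d))}

/-- The fundamental lemma of the calculus of variations; it makes weak derivatives unique. -/
lemma eq_of_inner_toL2_eq {g h : L2 Ω} (hgh : ∀ ψ : 𝓓(Ω, ℝ), ⟪g, toL2 ψ⟫ = ⟪h, toL2 ψ⟫) :
    g = h := by
  rw [← sub_eq_zero]
  set k := g - h with hk
  have hk0 : ∀ ψ : 𝓓(Ω, ℝ), ⟪k, toL2 ψ⟫ = 0 := fun ψ => by rw [hk, inner_sub_left, hgh, sub_self]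
  have hloc : LocallyIntegrable k (volume.restrict (Ω : Set (EuclideanSpace ℝ (Fin d)))) :=
    (Lp.memLp k).locallyIntegrable (by norm_num)
  have hae := Ω.isOpen.ae_eq_zero_of_integral_contDiff_smul_eq_zero
    (hloc.locallyIntegrableOn _) fun ψ h1 h2 h3 => by
      have := hk0 ⟨ψ, h1, h2, h3⟩
      rw [inner_toL2_right] at this
      rw [← this]
      exact integral_congr_ae (ae_of_all _ fun x => mul_comm _ _)
  refine (Lp.eq_zero_iff_ae_eq_zero).2 ?_
  filter_upwards [hae, ae_restrict_mem Ω.isOpen.measurableSet] with x hx hxΩ using hx hxΩ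

lemma inner_toL2_testDeriv (α : MIdx d) (φ ψ : 𝓓(Ω, ℝ)) :
    ⟪toL2 φ, toL2 (testDeriv Ω α ψ)⟫ = (-1) ^ α.order * ⟪toL2 (testDeriv Ω α φ), toL2 ψ⟫ := by
  rcases α with _ | i | q
  · simp [testDeriv, MIdx.order]
  · simp [testDeriv, MIdx.order, inner_lineDeriv_right]
  · simp only [testDeriv, MIdx.order]
    rw [inner_lineDeriv_right, inner_lineDeriv_right, lineDeriv_comm]
    ring

lemma inner_weakDeriv_toL2 (α : MIdx d) (u : H2 Ω) (ψ : 𝓓(Ω, ℝ)) :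
    ⟪weakDeriv α u, toL2 ψ⟫ = (-1) ^ α.order * ⟪toFun u, toL2 (testDeriv Ω α ψ)⟫ := by
  rw [inner_toL2_right, inner_toL2_right]
  exact u.2 α ψ

lemma weakDeriv_eq_toL2 {u : H2 Ω} {φ : 𝓓(Ω, ℝ)}
    (hu : toFun u =ᵐ[volume.restrict (Ω : Set (EuclideanSpace ℝ (Fin d)))] fun x => φ x)
    (α : MIdx d) : weakDeriv α u = toL2 (testDeriv Ω α φ) := by
  have h0 : toFun u = toL2 φ := Lp.ext (hu.trans (coeFn_toL2 φ).symm)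
  refine eq_of_inner_toL2_eq fun ψ => ?_
  rw [inner_weakDeriv_toL2, h0, inner_toL2_testDeriv, ← mul_assoc, ← mul_pow]
  simp

lemma span_testFunctions_subset : (Submodule.span ℝ (testFunctions Ω) : Set (H2 Ω)) ⊆
    testFunctions Ω := by
  intro u hu
  induction hu using Submodule.span_induction with
  | mem u hu => exact hu
  | zero =>
    refine ⟨0, ?_⟩
    filter_upwards [Lp.coeFn_zero ℝ 2 (volume.restrict (Ω : Set (EuclideanSpace ℝ (Fin d))))]
      with x hx using hx
  | add u v _ _ hu hv =>
    obtain ⟨φ, hφ⟩ := hu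
    obtain ⟨ψ, hψ⟩ := hv
    refine ⟨φ + ψ, ?_⟩
    filter_upwards [hφ, hψ, Lp.coeFn_add (toFun u) (toFun v)] with x h1 h2 h3
    exact h3.trans (by rw [Pi.add_apply, h1, h2]; rfl)
  | smul c u _ hu =>
    obtain ⟨φ, hφ⟩ := hu
    refine ⟨c • φ, ?_⟩
    filter_upwards [hφ, Lp.coeFn_smul c (toFun u)] with x h1 h2
    exact h2.trans (by rw [Pi.smul_apply, h1]; rfl)

/-- A closed property of elements of `H²(Ω)` that holds for test functions holds on `H²_0(Ω)`. -/
lemma H20_induction {p : H2 Ω → Prop} (hp : IsClosed {u | p u}) (h : ∀ u ∈ testFunctions Ω, p u)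
    (v : H20 Ω) : p v.1 :=
  closure_minimal (span_testFunctions_subset.trans h) hp v.2

/-- The weak derivative as a continuous linear map. -/
def weakDerivCLM (α : MIdx d) : H2 Ω →L[ℝ] L2 Ω :=
  (PiLp.proj 2 (fun _ : MIdx d => L2 Ω) α).comp (H2 Ω).subtypeL

lemma continuous_weakDeriv (α : MIdx d) : Continuous (weakDeriv (Ω := Ω) α) :=
  (weakDerivCLM α).continuous

lemma continuous_seminorm2 : Continuous (seminorm2 (Ω := Ω)) := by
  unfold seminorm2
  have := continuous_weakDeriv (Ω := Ω)
  fun_prop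

lemma continuous_laplacian : Continuous (laplacian (Ω := Ω)) := by
  unfold laplacian
  have := continuous_weakDeriv (Ω := Ω)
  fun_prop

lemma seminorm2_nonneg (u : H2 Ω) : 0 ≤ seminorm2 u := Real.sqrt_nonneg _

lemma norm_weakDeriv_le_seminorm2 (q : {q : Fin d × Fin d // q.1 ≤ q.2}) (u : H2 Ω) :
    ‖weakDeriv (.inr (.inr q)) u‖ ≤ seminorm2 u := by
  refine Real.le_sqrt_of_sq_le ?_
  exact Finset.single_le_sum (f := fun q => ‖weakDeriv (.inr (.inr q)) u‖ ^ 2)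
    (fun q _ => sq_nonneg _) (Finset.mem_univ q)

/-- For a test function, ‖Δφ‖² is the sum of ‖∂ᵢ∂ⱼφ‖² over all ordered pairs, while the seminorm
counts only i ≤ j; hence an inequality. -/
lemma seminorm2_le_norm_laplacian (v : H20 Ω) : seminorm2 v.1 ≤ ‖laplacian v.1‖ := by
  refine H20_induction (isClosed_le continuous_seminorm2 continuous_laplacian.norm) ?_ v
  rintro u ⟨φ, hφ⟩
  refine Real.sqrt_le_iff.2 ⟨norm_nonneg _, ?_⟩
  have h1 : ‖laplacian u‖ ^ 2 =
      ∑ q : Fin d × Fin d, ‖toL2 (∂_{basisVec q.1} (∂_{basisVec q.2} φ))‖ ^ 2 := by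
    rw [← real_inner_self_eq_norm_sq, laplacian, sum_inner, Fintype.sum_prod_type]
    refine Finset.sum_congr rfl fun i _ => ?_
    rw [inner_sum]
    refine Finset.sum_congr rfl fun j _ => ?_
    rw [weakDeriv_eq_toL2 hφ, weakDeriv_eq_toL2 hφ, norm_lineDeriv_lineDeriv_sq]
    rfl
  rw [h1]
  simp only [weakDeriv_eq_toL2 hφ]
  refine (Finset.sum_map Finset.univ
    (Function.Embedding.subtype fun q : Fin d × Fin d => q.1 ≤ q.2)
    fun q => ‖toL2 (∂_{basisVec q.1} (∂_{basisVec q.2} φ))‖ ^ 2).symm.trans_le ?_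
  exact Finset.sum_le_univ_sum_of_nonneg fun _ => sq_nonneg _

/-- Every weak derivative of order at most two is controlled by the second order ones. -/
lemma exists_norm_weakDeriv_le (hd : 0 < d)
    (hΩ : Bornology.IsBounded (Ω : Set (EuclideanSpace ℝ (Fin d)))) :
    ∃ M : ℝ, 1 ≤ M ∧ ∀ u ∈ testFunctions Ω, ∀ α, ‖weakDeriv α u‖ ≤ M * seminorm2 u := by
  obtain ⟨R, hR₀, hR⟩ := hΩ.exists_pos_norm_le
  refine ⟨1 + 2 * R + 2 * R * (2 * R), by nlinarith [mul_pos hR₀ hR₀], ?_⟩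
  rintro u ⟨φ, hφ⟩ α
  have hs := seminorm2_nonneg u
  have hRR : 0 ≤ 2 * R * (2 * R) := by positivity
  have h1 : ∀ i : Fin d, ‖toL2 (∂_{basisVec i} φ)‖ ≤ 2 * R * seminorm2 u := fun i => by
    refine (norm_toL2_le_lineDeriv hR₀.le hR i _).trans ?_
    refine mul_le_mul_of_nonneg_left ?_ (by positivity)
    have := norm_weakDeriv_le_seminorm2 ⟨(i, i), le_rfl⟩ u
    rwa [weakDeriv_eq_toL2 hφ] at this
  rcases α with _ | i | q
  -- Poincaré twice in one coordinate direction, which exists because 0 < d.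
  · have h2 := (norm_toL2_le_lineDeriv hR₀.le hR ⟨0, hd⟩ φ).trans
      (mul_le_mul_of_nonneg_left (h1 ⟨0, hd⟩) (by positivity))
    rw [weakDeriv_eq_toL2 hφ]
    refine h2.trans ?_
    rw [← mul_assoc]
    exact mul_le_mul_of_nonneg_right (by linarith) hs
  · rw [weakDeriv_eq_toL2 hφ]
    exact (h1 i).trans (mul_le_mul_of_nonneg_right (by linarith) hs)
  · exact (norm_weakDeriv_le_seminorm2 q u).trans (le_mul_of_one_le_left hs (by linarith))

/-- The Poincaré inequality in `H²_0(Ω)`. -/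
lemma exists_norm_le_seminorm2 (hd : 0 < d)
    (hΩ : Bornology.IsBounded (Ω : Set (EuclideanSpace ℝ (Fin d)))) :
    ∃ K : ℝ, 1 ≤ K ∧ ∀ v : H20 Ω, ‖v‖ ≤ K * seminorm2 v.1 := by
  obtain ⟨M, hM, h⟩ := exists_norm_weakDeriv_le hd hΩ
  refine ⟨Fintype.card (MIdx d) * M, ?_, fun v => ?_⟩
  · have : (1 : ℝ) ≤ Fintype.card (MIdx d) := by
      exact_mod_cast Fintype.card_pos_iff.2 ⟨Sum.inl ()⟩
    exact one_le_mul_of_one_le_of_one_le this hM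
  refine H20_induction (p := fun u => ‖u‖ ≤ _ * seminorm2 u)
    (isClosed_le continuous_norm (continuous_const.mul continuous_seminorm2)) ?_ v
  intro u hu
  have h1 : ‖u‖ ≤ ∑ α, ‖weakDeriv α u‖ := by
    rw [Submodule.coe_norm, PiLp.norm_eq_of_L2]
    refine Real.sqrt_le_iff.2 ⟨Finset.sum_nonneg fun _ _ => norm_nonneg _, ?_⟩
    exact Finset.sum_sq_le_sq_sum_of_nonneg fun _ _ => norm_nonneg _
  refine (h1.trans (Finset.sum_le_sum fun α _ => h u hu α)).trans_eq ?_
  simp [mul_assoc]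

/-- L² convergence gives an a.e. convergent subsequence, along which the pointwise bound passes to
the limit. -/
lemma isClosed_ae_abs_le (c : ℝ) :
    IsClosed {u : H2 Ω | ∀ᵐ x ∂(volume.restrict (Ω : Set (EuclideanSpace ℝ (Fin d)))),
      |toFun u x| ≤ c * seminorm2 u} := by
  refine IsSeqClosed.isClosed fun u v hu huv => ?_
  have h1 : Tendsto (fun n => toFun (u n)) atTop (𝓝 (toFun v)) :=
    ((continuous_weakDeriv _).tendsto v).comp huv
  obtain ⟨ns, hns, h2⟩ := (tendstoInMeasure_of_tendsto_Lp h1).exists_seq_tendsto_ae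
  have h3 : ∀ᵐ x ∂(volume.restrict (Ω : Set (EuclideanSpace ℝ (Fin d)))),
      ∀ n, |toFun (u n) x| ≤ c * seminorm2 (u n) := ae_all_iff.2 hu
  filter_upwards [h2, h3] with x hx hx'
  refine le_of_tendsto_of_tendsto' hx.abs ?_ fun n => hx' (ns n)
  exact (((continuous_seminorm2.tendsto v).comp huv).comp hns.tendsto_atTop).const_mul c

/-- The Sobolev embedding of `H²_0(Ω)` into the bounded functions. -/
lemma exists_isEmbeddingConst (hd : 0 < d) (hd4 : d < 4)
    (hΩ : Bornology.IsBounded (Ω : Set (EuclideanSpace ℝ (Fin d)))) :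
    ∃ c : ℝ, 0 < c ∧ IsEmbeddingConst Ω c := by
  obtain ⟨M, hM, h⟩ := exists_norm_weakDeriv_le hd hΩ
  obtain ⟨S, hS, hS'⟩ := abs_le_norm_toL2 (Ω := Ω) hd4
  -- The added 1 only makes the constant positive, as S may vanish.
  refine ⟨S * (M + d * M) + 1, by positivity, H20_induction (isClosed_ae_abs_le _) ?_⟩
  rintro u ⟨φ, hφ⟩
  have h0 := seminorm2_nonneg u
  have h1 : ‖toL2 φ‖ + ∑ i : Fin d, ‖toL2 (∂_{basisVec i} (∂_{basisVec i} φ))‖ ≤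
      (M + d * M) * seminorm2 u := by
    have h2 := h u ⟨φ, hφ⟩
    simp only [weakDeriv_eq_toL2 hφ] at h2
    have h3 := Finset.sum_le_sum fun (i : Fin d) (_ : i ∈ Finset.univ) =>
      h2 (.inr (.inr ⟨(i, i), le_rfl⟩))
    simp only [Finset.sum_const, Finset.card_univ, Fintype.card_fin, nsmul_eq_mul] at h3
    have h4 := h2 (.inl ())
    refine (add_le_add h4 h3).trans_eq ?_
    ring
  filter_upwards [hφ] with x hx
  rw [hx]
  have := (hS' φ x).trans (mul_le_mul_of_nonneg_left h1 hS)
  linarith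

lemma IsEmbeddingConst.mono {c c' : ℝ} (hc : IsEmbeddingConst Ω c) (h : c ≤ c') :
    IsEmbeddingConst Ω c' := fun v => by
  filter_upwards [hc v] with x hx
  exact hx.trans (mul_le_mul_of_nonneg_right h (seminorm2_nonneg _))

end Density

/-! ### Pointwise inequalities for the nonlinearity. -/

section Iteration

open scoped RealInnerProductSpace

/-- Bernoulli's inequality for s ≥ 1; t ≤ t^s for s ≤ 1. -/
lemma one_sub_rpow_le {s t : ℝ} (ht₀ : 0 ≤ t) (ht₁ : t ≤ 1) :
    1 - t ^ s ≤ max s 1 * (1 - t) := by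
  rcases le_total 1 s with h | h
  · have h1 := one_add_mul_self_le_rpow_one_add (s := t - 1) (by linarith) h
    rw [max_eq_left h]
    rw [add_sub_cancel] at h1
    linarith
  · have h1 := Real.self_le_rpow_of_le_one ht₀ ht₁ h
    rw [max_eq_right h]
    linarith

/-- The previous bound at t = x / y, rescaled. The extra factor y compensates for the failure of t ↦
t^s to be Lipschitz at 0 when s < 1. -/
lemma rpow_sub_rpow_mul_le {s x y : ℝ} (hx : 0 ≤ x) (hxy : x ≤ y) :
    (y ^ s - x ^ s) * y ≤ max s 1 * y ^ s * (y - x) := by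
  rcases (hx.trans hxy).eq_or_lt with hy | hy
  · obtain rfl : x = y := le_antisymm hxy (hy ▸ hx)
    simp
  have h1 := one_sub_rpow_le (s := s) (div_nonneg hx hy.le) (div_le_one_of_le₀ hxy hy.le)
  have hys := Real.rpow_pos_of_pos hy s
  rw [Real.div_rpow hx hy.le] at h1
  have h2 := mul_le_mul_of_nonneg_left h1 (mul_pos hys hy).le
  have h3 : y ^ s * y * (1 - x ^ s / y ^ s) = (y ^ s - x ^ s) * y := by field_simp
  have h4 : y ^ s * y * (max s 1 * (1 - x / y)) = max s 1 * y ^ s * (y - x) := by field_simp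
  rwa [h3, h4] at h2

lemma abs_rpow_sub_rpow_mul_le {s a b M : ℝ} (hs : 0 ≤ s) (ha : |a| ≤ M) (hb : |b| ≤ M) :
    |(|a| ^ s - |b| ^ s) * b| ≤ max s 1 * M ^ s * |a - b| := by
  have hm : 0 ≤ max s 1 := zero_le_one.trans (le_max_right _ _)
  have key : ∀ x y : ℝ, |x| ≤ |y| → |y| ≤ M →
      (|y| ^ s - |x| ^ s) * |y| ≤ max s 1 * M ^ s * |y - x| := by
    intro x y hxy hyM
    refine (rpow_sub_rpow_mul_le (abs_nonneg x) hxy).trans ?_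
    have := Real.rpow_le_rpow (abs_nonneg y) hyM hs
    have hM := Real.rpow_nonneg ((abs_nonneg y).trans hyM) s
    gcongr
    exact abs_sub_abs_le_abs_sub y x
  rw [abs_mul]
  rcases le_total |a| |b| with h | h
  · have h1 := Real.rpow_le_rpow (abs_nonneg a) h hs
    rw [abs_sub_comm, abs_of_nonneg (sub_nonneg.2 h1), abs_sub_comm a b]
    exact key a b h hb
  · have h1 := Real.rpow_le_rpow (abs_nonneg b) h hs
    rw [abs_of_nonneg (sub_nonneg.2 h1)]
    -- Here |b| ≤ |a|, so the outer factor |b| may be raised to |a|, the larger base.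
    exact (mul_le_mul_of_nonneg_left h (sub_nonneg.2 h1)).trans
      (key b a h ha)

lemma neg_le_rpow_mul_sub_rpow_mul {s a b y M c D : ℝ} (hs : 0 ≤ s) (ha : |a| ≤ M) (hb : |b| ≤ M)
    (hD : |a - b| ≤ D) (hc : |y - b| ≤ c) :
    -(max s 1 * M ^ s * D * c) ≤ |a| ^ s * y * (y - b) - |b| ^ s * b * (y - b) := by
  have hm : 0 ≤ max s 1 := zero_le_one.trans (le_max_right _ _)
  have hM : 0 ≤ M ^ s := Real.rpow_nonneg ((abs_nonneg _).trans ha) _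
  have h1 : |(|a| ^ s - |b| ^ s) * b * (y - b)| ≤ max s 1 * M ^ s * D * c := by
    rw [abs_mul]
    exact mul_le_mul ((abs_rpow_sub_rpow_mul_le hs ha hb).trans
      (mul_le_mul_of_nonneg_left hD (by positivity))) hc (abs_nonneg _)
      (mul_nonneg (by positivity) ((abs_nonneg _).trans hD))
  -- The difference is |a|^s (y - b)² + (|a|^s - |b|^s) b (y - b); the square is discarded.
  have h2 : 0 ≤ |a| ^ s * ((y - b) * (y - b)) := mul_nonneg (by positivity) (mul_self_nonneg _)
  linarith [neg_le_of_abs_le h1]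

lemma neg_le_integral_rpow_mul_sub {X : Type*} [MeasurableSpace X] {μ : Measure X}
    [IsFiniteMeasure μ] {s M c D : ℝ} {a b y e g : X → ℝ} (hs : 0 ≤ s)
    (ha : ∀ᵐ x ∂μ, |a x| ≤ M) (hb : ∀ᵐ x ∂μ, |b x| ≤ M) (hg : ∀ᵐ x ∂μ, |g x| ≤ D)
    (he : ∀ᵐ x ∂μ, |e x| ≤ c) (hg' : g =ᵐ[μ] a - b) (he' : e =ᵐ[μ] y - b)
    (h1 : Integrable (fun x => |a x| ^ s * y x * e x) μ)
    (h2 : Integrable (fun x => |b x| ^ s * b x * e x) μ) :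
    -(μ.real Set.univ * (max s 1 * M ^ s * D * c)) ≤
      (∫ x, |a x| ^ s * y x * e x ∂μ) - ∫ x, |b x| ^ s * b x * e x ∂μ := by
  have h3 : ∫ _, -(max s 1 * M ^ s * D * c) ∂μ ≤
      ∫ x, (|a x| ^ s * y x * e x - |b x| ^ s * b x * e x) ∂μ := by
    refine integral_mono_ae (integrable_const _) (h1.sub h2) ?_
    filter_upwards [ha, hb, hg, he, hg', he'] with x k1 k2 k3 k4 k5 k6
    rw [k5, Pi.sub_apply] at k3
    rw [k6, Pi.sub_apply] at k4
    rw [k6, Pi.sub_apply]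
    exact neg_le_rpow_mul_sub_rpow_mul hs k1 k2 k3 k4
  rwa [integral_sub h1 h2, integral_const, smul_eq_mul, mul_neg] at h3

/-! ### One step of the iteration: a priori bound and contraction. -/

variable {d : ℕ} {Ω : Opens (EuclideanSpace ℝ (Fin d))}

lemma laplacian_sub (u v : H2 Ω) : laplacian (u - v) = laplacian u - laplacian v := by
  simp only [laplacian, ← Finset.sum_sub_distrib]
  rfl

lemma integral_laplacian_mul (u v : H2 Ω) :
    ∫ x in (Ω : Set (EuclideanSpace ℝ (Fin d))), laplacian u x * laplacian v x =
      ⟪laplacian u, laplacian v⟫ := by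
  rw [L2.inner_def]
  simp [mul_comm]

lemma integrable_rpow_mul_mul {c s : ℝ} (hs : 0 ≤ s) (hc : IsEmbeddingConst Ω c)
    (hΩ : Bornology.IsBounded (Ω : Set (EuclideanSpace ℝ (Fin d)))) (u v w : H20 Ω) :
    Integrable (fun x => |toFun u.1 x| ^ s * toFun v.1 x * toFun w.1 x)
      (volume.restrict (Ω : Set (EuclideanSpace ℝ (Fin d)))) := by
  have : Fact (volume (Ω : Set (EuclideanSpace ℝ (Fin d))) < ⊤) := ⟨hΩ.measure_lt_top⟩
  have hm : ∀ a : H20 Ω, AEMeasurable (toFun a.1)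
      (volume.restrict (Ω : Set (EuclideanSpace ℝ (Fin d)))) := fun a =>
    (Lp.aestronglyMeasurable _).aemeasurable
  have hu := hm u
  have hv := hm v
  have hw := hm w
  refine Integrable.of_bound (C := (c * seminorm2 u.1) ^ s * (c * seminorm2 v.1) *
    (c * seminorm2 w.1)) (AEMeasurable.aestronglyMeasurable (by fun_prop)) ?_
  filter_upwards [hc u, hc v, hc w] with x h1 h2 h3
  rw [norm_mul, norm_mul, Real.norm_of_nonneg (by positivity), Real.norm_eq_abs, Real.norm_eq_abs]
  have h4 := (abs_nonneg _).trans h1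
  have h5 := (abs_nonneg _).trans h2
  gcongr

lemma SolvesDiscrete.solvesStep {lam p : ℝ} {f : Hm2 Ω} {Vh : Submodule ℝ (H20 Ω)} {uh : Vh}
    (h : SolvesDiscrete lam p f Vh uh) : SolvesStep lam p f Vh uh uh := fun vh => by
  rw [← h vh, ← integral_const_mul]
  simp only [mul_assoc]

lemma semi_nonneg {Vh : Submodule ℝ (H20 Ω)} (v : Vh) : 0 ≤ semi v := seminorm2_nonneg _

lemma semi_sq_le_inner_laplacian {Vh : Submodule ℝ (H20 Ω)} (v : Vh) :
    semi v ^ 2 ≤ ⟪laplacian (v : H20 Ω).1, laplacian (v : H20 Ω).1⟫ := by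
  rw [real_inner_self_eq_norm_sq]
  exact pow_le_pow_left₀ (semi_nonneg v) (seminorm2_le_norm_laplacian _) 2

lemma abs_apply_le_norm (f : Hm2 Ω) (v : H20 Ω) : |f v| ≤ ‖f‖ * ‖v‖ :=
  @ContinuousLinearMap.le_opNorm ℝ ℝ (H20 Ω) ℝ _ _ _ _ (H20 Ω).normedSpace _ (RingHom.id ℝ) _ f v

/-- Testing with w itself makes the nonlinear term nonnegative, leaving |w|₂² ≤ ‖f‖ K |w|₂. -/
lemma SolvesStep.semi_le {lam p K : ℝ} {f : Hm2 Ω} {Vh : Submodule ℝ (H20 Ω)} {u w : Vh}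
    (h : SolvesStep lam p f Vh u w) (hlam : 0 ≤ lam)
    (hK₀ : 0 ≤ K) (hK : ∀ v : H20 Ω, ‖v‖ ≤ K * seminorm2 v.1) : semi w ≤ K * ‖f‖ := by
  have h1 := h w
  rw [integral_laplacian_mul] at h1
  have h2 : 0 ≤ ∫ x in (Ω : Set (EuclideanSpace ℝ (Fin d))),
      |toFun (u : H20 Ω).1 x| ^ (2 * p) * toFun (w : H20 Ω).1 x * toFun (w : H20 Ω).1 x :=
    integral_nonneg fun x => by
      rw [mul_assoc]
      exact mul_nonneg (by positivity) (mul_self_nonneg _)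
  have h3 : f (w : H20 Ω) ≤ ‖f‖ * (K * semi w) :=
    ((le_abs_self _).trans (abs_apply_le_norm f _)).trans
      (mul_le_mul_of_nonneg_left (hK _) (norm_nonneg f))
  have h4 := semi_sq_le_inner_laplacian w
  have h5 := mul_nonneg hlam h2
  rcases (semi_nonneg w).eq_or_lt with h0 | h0
  · rw [← h0]
    positivity
  · refine le_of_mul_le_mul_left ?_ h0
    nlinarith

lemma SolvesStep.semi_sub_le {lam p c M : ℝ} {f : Hm2 Ω} {Vh : Submodule ℝ (H20 Ω)} {u w uh : Vh}
    (h : SolvesStep lam p f Vh u w) (hh : SolvesStep lam p f Vh uh uh) (hlam : 0 ≤ lam)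
    (hp : 0 ≤ p) (hc₀ : 0 ≤ c) (hc : IsEmbeddingConst Ω c)
    (hΩ : Bornology.IsBounded (Ω : Set (EuclideanSpace ℝ (Fin d))))
    (hu : semi u ≤ M) (huh : semi uh ≤ M) :
    semi (w - uh) ≤ lam * volume.real (Ω : Set (EuclideanSpace ℝ (Fin d))) *
      max (2 * p) 1 * (c * M) ^ (2 * p) * c * c * semi (u - uh) := by
  have : Fact (volume (Ω : Set (EuclideanSpace ℝ (Fin d))) < ⊤) := ⟨hΩ.measure_lt_top⟩
  set e := w - uh with he
  have hM : 0 ≤ M := (semi_nonneg u).trans hu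
  have hp2 : 0 ≤ 2 * p := by linarith
  have h1 := h e
  have h2 := hh e
  rw [integral_laplacian_mul] at h1 h2
  have h3 : ⟪laplacian (e : H20 Ω).1, laplacian (e : H20 Ω).1⟫ =
      ⟪laplacian (w : H20 Ω).1, laplacian (e : H20 Ω).1⟫ -
        ⟪laplacian (uh : H20 Ω).1, laplacian (e : H20 Ω).1⟫ := by
    rw [← inner_sub_left, ← laplacian_sub]
    rfl
  have h4 := neg_le_integral_rpow_mul_sub hp2
    ((hc u).mono fun x hx => hx.trans (mul_le_mul_of_nonneg_left hu hc₀))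
    ((hc uh).mono fun x hx => hx.trans (mul_le_mul_of_nonneg_left huh hc₀))
    (hc ((u - uh : Vh) : H20 Ω)) (hc (e : H20 Ω))
    (Lp.coeFn_sub (toFun (u : H20 Ω).1) (toFun (uh : H20 Ω).1))
    (Lp.coeFn_sub (toFun (w : H20 Ω).1) (toFun (uh : H20 Ω).1))
    (integrable_rpow_mul_mul hp2 hc hΩ u w e) (integrable_rpow_mul_mul hp2 hc hΩ uh uh e)
  rw [measureReal_restrict_apply_univ] at h4
  rw [show seminorm2 ((u - uh : Vh) : H20 Ω).1 = semi (u - uh) from rfl,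
    show seminorm2 (e : H20 Ω).1 = semi e from rfl] at h4
  have h5 := mul_le_mul_of_nonneg_left h4 hlam
  rw [mul_sub] at h5
  have h6 := semi_sq_le_inner_laplacian e
  rw [h3] at h6
  rcases (semi_nonneg e).eq_or_lt with h0 | h0
  · rw [← h0]
    have := semi_nonneg (u - uh)
    have hcM : 0 ≤ (c * M) ^ (2 * p) := Real.rpow_nonneg (mul_nonneg hc₀ hM) _
    positivity
  · refine le_of_mul_le_mul_left ?_ h0
    linarith

lemma contraction_consequences {a : ℕ → ℝ} {q : ℝ} {P : Prop} (ha : ∀ n, 0 ≤ a n) (hq : 0 ≤ q)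
    (h : ∀ n, (1 ≤ n ∨ P) → a (n + 1) ≤ q * a n) :
    (∀ n, (1 ≤ n ∨ P) → a (n + 1) ≤ q * a n) ∧ (∀ n, a (n + 1) ≤ q ^ n * a 1) ∧
      (P → ∀ n, a n ≤ q ^ n * a 0) ∧ (q < 1 → Tendsto a atTop (𝓝 0)) := by
  have hpow : ∀ n, a (n + 1) ≤ q ^ n * a 1 := by
    intro n
    induction n with
    | zero => simp
    | succ n ih =>
      refine (h (n + 1) (Or.inl (by omega))).trans ?_
      rw [pow_succ', mul_assoc]
      exact mul_le_mul_of_nonneg_left ih hq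
  refine ⟨h, hpow, fun h0 n => ?_, fun hq1 => ?_⟩
  · induction n with
    | zero => simp
    | succ n ih =>
      refine (h n (Or.inr h0)).trans ?_
      rw [pow_succ', mul_assoc]
      exact mul_le_mul_of_nonneg_left ih hq
  -- The shift by one is needed because the step from index 0 need not contract.
  · refine (tendsto_add_atTop_iff_nat 1).1 (squeeze_zero (fun n => ha _) hpow ?_)
    simpa using (tendsto_pow_atTop_nhds_zero_of_lt_one hq hq1).mul_const (a 1)

lemma constA_nonneg {c₁ c₂ p : ℝ} (hc₁ : 0 ≤ c₁) (hc₂ : 0 ≤ c₂) (f : Hm2 Ω) :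
    0 ≤ constA Ω c₁ c₂ p f := by
  have hf : 0 ≤ ‖f‖ ^ (2 * p) := Real.rpow_nonneg (norm_nonneg f) _
  unfold constA
  positivity

lemma constB_nonneg {C₁ c₂' c₃ p : ℝ} (hp : 0 ≤ p) (hC₁ : 0 ≤ C₁) (hc₂' : 0 ≤ c₂')
    (hc₃ : 0 ≤ c₃) (f : Hm2 Ω) : 0 ≤ constB Ω C₁ c₂' c₃ p f := by
  have hf : 0 ≤ ‖f‖ ^ (2 * p) := Real.rpow_nonneg (norm_nonneg f) _
  unfold constB
  positivity

/-- Since 1 ≤ p / p₀; the lower bound on p is needed because 4p alone would not dominate 1 for small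
p. -/
lemma max_le_four_mul {p₀ p : ℝ} (hp₀ : 0 < p₀) (hp : p₀ ≤ p) :
    max (2 * p) 1 ≤ 4 * p * max 1 p₀⁻¹ := by
  have hp_pos : 0 < p := hp₀.trans_le hp
  have h1 : 1 ≤ p * p₀⁻¹ := by
    rw [← div_eq_mul_inv]
    exact (one_le_div hp₀).2 hp
  have h2 := mul_le_mul_of_nonneg_left (le_max_left 1 p₀⁻¹) hp_pos.le
  have h3 := mul_le_mul_of_nonneg_left (le_max_right 1 p₀⁻¹) hp_pos.le
  exact max_le (by linarith) (by linarith)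

lemma contraction_factor_le_constB {c K p₀ p : ℝ} (hp₀ : 0 < p₀) (hp : p₀ ≤ p) (hc : 0 ≤ c)
    (hK : 0 ≤ K) (f : Hm2 Ω) :
    volume.real (Ω : Set (EuclideanSpace ℝ (Fin d))) * max (2 * p) 1 *
      (c * (K * ‖f‖)) ^ (2 * p) * c * c ≤ constB Ω (c * K) c (c * max 1 p₀⁻¹) p f := by
  have hf : 0 ≤ ‖f‖ := norm_nonneg f
  unfold constB
  generalize ‖f‖ = F at *
  rw [← mul_assoc c K F, Real.mul_rpow (by positivity) hf]
  have h1 : 0 ≤ volume.real (Ω : Set (EuclideanSpace ℝ (Fin d))) * (c * K) ^ (2 * p) *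
    F ^ (2 * p) * c * c := by positivity
  have h2 := mul_le_mul_of_nonneg_left (max_le_four_mul hp₀ hp) h1
  linarith

lemma semi_le_mul_norm {lam p K : ℝ} {f : Hm2 Ω} {Vh : Submodule ℝ (H20 Ω)} {u : ℕ → Vh}
    (hu : ∀ n, SolvesStep lam p f Vh (u n) (u (n + 1))) (hlam : 0 ≤ lam) (hK₁ : 1 ≤ K)
    (hK : ∀ v : H20 Ω, ‖v‖ ≤ K * seminorm2 v.1) (n : ℕ) (hn : 1 ≤ n ∨ semi (u 0) ≤ ‖f‖) :
    semi (u n) ≤ K * ‖f‖ := by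
  rcases n with _ | n
  · exact (hn.resolve_left (by norm_num)).trans (le_mul_of_one_le_left (norm_nonneg f) hK₁)
  · exact (hu n).semi_le hlam (zero_le_one.trans hK₁) hK

end Iteration

end Plate

end

theorem mainTheorem4 {d : ℕ} (hd : d = 2 ∨ d = 3)
    (Ω : TopologicalSpace.Opens (EuclideanSpace ℝ (Fin d)))
    (hΩ : Bornology.IsBounded (Ω : Set (EuclideanSpace ℝ (Fin d))))
    (p₀ : ℝ) (hp₀ : 0 < p₀) :
    ∃ C₁ c₂' c₃ : ℝ, 0 < C₁ ∧ 0 < c₂' ∧ 0 < c₃ ∧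
      Plate.IsEmbeddingConst Ω C₁ ∧ Plate.IsEmbeddingConst Ω c₂' ∧ Plate.IsEmbeddingConst Ω c₃ ∧
      ∀ c₁ c₂ : ℝ, 0 < c₁ → 0 < c₂ →
      ∀ (p lam : ℝ), p₀ ≤ p → 0 < lam →
      ∀ (f : Plate.Hm2 Ω) (Vh : Submodule ℝ (Plate.H20 Ω)) [FiniteDimensional ℝ Vh]
        (uh : Vh) (u : ℕ → Vh),
        Plate.SolvesDiscrete lam p f Vh uh →
        (∀ n, Plate.SolvesStep lam p f Vh (u n) (u (n + 1))) →
        0 < 1 - lam * Plate.constA Ω c₁ c₂ p f →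
        ∀ q : ℝ,
        q = lam * (1 - lam * Plate.constA Ω c₁ c₂ p f)⁻¹ * Plate.constB Ω C₁ c₂' c₃ p f →
        (∀ n, (1 ≤ n ∨ Plate.semi (u 0) ≤ ‖f‖) →
          Plate.semi (u (n + 1) - uh) ≤ q * Plate.semi (u n - uh)) ∧
        (∀ n, Plate.semi (u (n + 1) - uh) ≤ q ^ n * Plate.semi (u 1 - uh)) ∧
        (Plate.semi (u 0) ≤ ‖f‖ →
          ∀ n, Plate.semi (u n - uh) ≤ q ^ n * Plate.semi (u 0 - uh)) ∧
        (q < 1 → Tendsto (fun n => Plate.semi (u n - uh)) atTop (𝓝 0)) := by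
  have hd₀ : 0 < d := by omega
  obtain ⟨K, hK₁, hK⟩ := Plate.exists_norm_le_seminorm2 hd₀ hΩ
  obtain ⟨c, hc₀, hc⟩ := Plate.exists_isEmbeddingConst hd₀ (by omega : d < 4) hΩ
  have hm₁ : 1 ≤ max 1 p₀⁻¹ := le_max_left _ _
  -- C₁ absorbs the a priori bound K‖f‖, and c₃ the ratio of max(2p, 1) to 4p. Enlarging an
  -- embedding constant keeps it one.
  refine ⟨c * K, c, c * max 1 p₀⁻¹, by positivity, hc₀, by positivity,
    hc.mono (le_mul_of_one_le_right hc₀.le hK₁), hc,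
    hc.mono (le_mul_of_one_le_right hc₀.le hm₁), ?_⟩
  intro c₁ c₂ hc₁ hc₂ p lam hp hlam f Vh _ uh u huh hu hA q hq
  have hp_pos : 0 < p := hp₀.trans_le hp
  have hK₀ : 0 < K := zero_lt_one.trans_le hK₁
  have hA₀ := Plate.constA_nonneg (p := p) hc₁.le hc₂.le f
  have hB₀ := Plate.constB_nonneg (C₁ := c * K) (c₃ := c * max 1 p₀⁻¹) hp_pos.le (by positivity)
    hc₀.le (by positivity) f
  have hB := Plate.contraction_factor_le_constB hp₀ hp hc₀.le hK₀.le f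
  have hq₁ : lam * Plate.constB Ω (c * K) c (c * max 1 p₀⁻¹) p f ≤ q := by
    rw [hq]
    refine mul_le_mul_of_nonneg_right (le_mul_of_one_le_right hlam.le ?_) hB₀
    exact (one_le_inv₀ hA).2 (sub_le_self _ (mul_nonneg hlam.le hA₀))
  have hcontr : ∀ n, (1 ≤ n ∨ Plate.semi (u 0) ≤ ‖f‖) →
      Plate.semi (u (n + 1) - uh) ≤ q * Plate.semi (u n - uh) := fun n hn => by
    refine ((hu n).semi_sub_le huh.solvesStep hlam.le hp_pos.le hc₀.le hc hΩ
      (Plate.semi_le_mul_norm hu hlam.le hK₁ hK n hn)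
      (huh.solvesStep.semi_le hlam.le hK₀.le hK)).trans ?_
    refine mul_le_mul_of_nonneg_right (le_trans ?_ hq₁) (Plate.semi_nonneg _)
    refine le_trans (le_of_eq ?_) (mul_le_mul_of_nonneg_left hB hlam.le)
    ring
  exact Plate.contraction_consequences (a := fun n => Plate.semi (u n - uh))
    (P := Plate.semi (u 0) ≤ ‖f‖) (fun n => Plate.semi_nonneg (u n - uh))
    ((mul_nonneg hlam.le hB₀).trans hq₁) hcontr
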